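/- Consider first-order logic $\mathsf{FO}$ with equality and without constant and function symbols, with formulas $\varphi ::= \top \mid P(x_1,\dots,x_n)\mid x_1=x_2\mid \varphi\wedge\varphi'\mid\neg\varphi\mid\exists x\,\varphi$, over countably many individual variables and countably many predicate symbols $P$ of each arity $n\ge 0$; structures have nonempty domains. Write $\varphi\models\psi$ if, for every structure and every assignment in it, truth of $\varphi$ implies truth of $\psi$. An $\mathsf{FO}$-fragment is a set $\mathsf F$ of $\mathsf{FO}$-formulas; it is called decidable if there is an algorithm that, given $\varphi,\psi\in\mathsf F$, decides whether $\varphi\models\psi$ (if $\mathsf F$ is closed under $\wedge$ and $\neg$, this amounts to deciding validity of $\mathsf F$-formulas). Formulas of propositional modal logic $\mathsf{ML}$, $\chi ::= \top\mid p\mid\chi\wedge\chi'\mid\neg\chi\mid\Diamond\chi$ (with countably many propositional variables $p$), are regarded as $\mathsf{FO}$-formulas by means of the standard translation with two distinct individual variables $x,y$, a binary predicate symbol $R$ and a unary predicate symbol $p$ for each propositional variable $p$: $\top^*_x=(x=x)$, $p^*_x=p(x)$, $(\chi\wedge\chi')^*_x=\chi^*_x\wedge\chi'^*_x$, $(\neg\chi)^*_x=\neg\chi^*_x$,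 $(\Diamond\chi)^*_x=\exists y\,(R(x,y)\wedge\chi^*_y)$, and likewise for $\chi^*_y$ with $x$ and $y$ swapped. A fragment $\mathsf F$ contains $\mathsf{ML}$ if $\chi^*_x\in\mathsf F$ for every $\mathsf{ML}$-formula $\chi$. Theorem. For any decidable $\mathsf{FO}$-fragment $\mathsf F$ containing $\mathsf{ML}$, $\mathsf F/\mathsf{ML}$-definability is decidable: there is an algorithm that, given a formula $\varphi\in\mathsf F$, decides whether there exists an $\mathsf{ML}$-formula $\chi$ such that $\varphi\models\chi^*_x$ and $\chi^*_x\models\varphi$. -/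

import Mathlib

namespace ModalDefinability

/-! ## First-order logic with equality, without constants and function symbols

Individual variables are natural numbers.  For every arity `n` there are countably many predicate
symbols of arity `n`; the symbol with index `i` and arity `n` is the pair `(i, n)`. -/

/-- First-order formulas.  `rel i [x₁, …, xₙ]` is the atom `P(x₁, …, xₙ)`, where `P` is the
predicate symbol with index `i` and arity `n`. -/
inductive FO : Type
  | top : FO
  | rel (i : ℕ) (args : List ℕ) : FO
  | eq (x y : ℕ) : FO
  | and (φ ψ : FO) : FO
  | not (φ : FO) : FO
  | ex (x : ℕ) (φ : FO) : FO

/-- A relational structure: a nonempty domain and an `n`-ary relation on it for every predicate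
symbol `(i, n)`. -/
structure Struc : Type 1 where
  dom : Type
  nonempty : Nonempty dom
  rel : (i n : ℕ) → (Fin n → dom) → Prop

/-- `φ.Sat A v`: the formula `φ` is true in `A` under the assignment `v`. -/
def FO.Sat (A : Struc) : FO → (ℕ → A.dom) → Prop
  | .top, _ => True
  | .rel i args, v => A.rel i args.length (fun k => v (args.get k))
  | .eq x y, v => v x = v y
  | .and φ ψ, v => φ.Sat A v ∧ ψ.Sat A v
  | .not φ, v => ¬ φ.Sat A v
  | .ex x φ, v => ∃ a : A.dom, φ.Sat A (Function.update v x a)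

/-- Entailment `φ ⊨ ψ`. -/
def FO.Entails (φ ψ : FO) : Prop :=
  ∀ (A : Struc) (v : ℕ → A.dom), φ.Sat A v → ψ.Sat A v

/-! ## Propositional modal logic and its standard translation -/

/-- Formulas of propositional modal logic with one possibility operator `dia`; `var i` is the
`i`-th propositional variable. -/
inductive ML : Type
  | top : ML
  | var (i : ℕ) : ML
  | and (φ ψ : ML) : ML
  | not (φ : ML) : ML
  | dia (φ : ML) : ML

/-- The standard translation of a modal formula, with the free variable `x`, using the two
individual variables `x` and `y`.  The accessibility relation is the binary predicate symbol with
index `0`, and the propositional variable `var i` is the unary predicate symbol with index `i`. -/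
def ML.st : ML → ℕ → ℕ → FO
  | .top, x, _ => .eq x x
  | .var i, x, _ => .rel i [x]
  | .and φ ψ, x, y => .and (φ.st x y) (ψ.st x y)
  | .not φ, x, y => .not (φ.st x y)
  | .dia φ, x, y => .ex y (.and (.rel 0 [x, y]) (φ.st y x))

/-- The set of first-order formulas `F` contains modal logic (written with the variables `x`
and `y`): it contains the standard translation of every modal formula. -/
def ContainsML (F : Set FO) (x y : ℕ) : Prop :=
  ∀ χ : ML, χ.st x y ∈ F

/-- The formula `φ` is definable by a modal formula (evaluated at `x`): there is a modal formula
`χ` with `φ ⊨ χ` and `χ ⊨ φ`. -/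
def MLDefinable (x y : ℕ) (φ : FO) : Prop :=
  ∃ χ : ML, φ.Entails (χ.st x y) ∧ (χ.st x y).Entails φ

/-! ## Formulas as inputs of algorithms -/

/-- A Gödel numbering of the first-order formulas. -/
def FO.encodeFO : FO → ℕ
  | .top => 0
  | .rel i args => 5 * Nat.pair i (Encodable.encode args) + 1
  | .eq x y => 5 * Nat.pair x y + 2
  | .and φ ψ => 5 * Nat.pair φ.encodeFO ψ.encodeFO + 3
  | .not φ => 5 * φ.encodeFO + 4
  | .ex x φ => 5 * Nat.pair x φ.encodeFO + 5

/-- The inverse of the Gödel numbering. -/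
def FO.ofNatFO : ℕ → FO
  | 0 => .top
  | n + 1 =>
    let m := n / 5
    have hm : m < n + 1 := Nat.lt_succ_of_le (Nat.div_le_self n 5)
    have _h1 : m.unpair.1 < n + 1 := lt_of_le_of_lt m.unpair_left_le hm
    have _h2 : m.unpair.2 < n + 1 := lt_of_le_of_lt m.unpair_right_le hm
    match n % 5 with
    | 0 => .rel m.unpair.1 (Denumerable.ofNat (List ℕ) m.unpair.2)
    | 1 => .eq m.unpair.1 m.unpair.2
    | 2 => .and (FO.ofNatFO m.unpair.1) (FO.ofNatFO m.unpair.2)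
    | 3 => .not (FO.ofNatFO m)
    | _ => .ex m.unpair.1 (FO.ofNatFO m.unpair.2)
  termination_by n => n
  decreasing_by all_goals assumption

theorem FO.ofNatFO_encodeFO (φ : FO) : FO.ofNatFO φ.encodeFO = φ := by
  induction φ with
  | top => simp [FO.encodeFO, FO.ofNatFO]
  | rel i args =>
    rw [FO.encodeFO, FO.ofNatFO]
    simp
  | eq x y =>
    rw [FO.encodeFO, FO.ofNatFO]
    simp [Nat.add_mod, Nat.add_div]
  | and φ ψ h1 h2 =>
    rw [FO.encodeFO, FO.ofNatFO]
    simp [Nat.add_mod, Nat.add_div, h1, h2]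
  | not φ h =>
    rw [FO.encodeFO, FO.ofNatFO]
    simp [Nat.add_mod, Nat.add_div, h]
  | ex x φ h =>
    rw [FO.encodeFO, FO.ofNatFO]
    simp [Nat.add_mod, Nat.add_div, h]

theorem FO.encodeFO_ofNatFO (n : ℕ) : (FO.ofNatFO n).encodeFO = n := by
  induction n using Nat.strong_induction_on with
  | _ n ih =>
    cases n with
    | zero => simp [FO.ofNatFO, FO.encodeFO]
    | succ n =>
      have hm : n / 5 < n + 1 := Nat.lt_succ_of_le (Nat.div_le_self n 5)
      have e0 := ih _ hm
      have e1 := ih _ (lt_of_le_of_lt (n / 5).unpair_left_le hm)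
      have e2 := ih _ (lt_of_le_of_lt (n / 5).unpair_right_le hm)
      have hd := Nat.div_add_mod n 5
      have hr : n % 5 < 5 := Nat.mod_lt _ (by norm_num)
      rw [FO.ofNatFO]
      generalize n % 5 = r at hd hr
      interval_cases r <;> simp [FO.encodeFO, e0, e1, e2] <;> omega

instance : Denumerable FO :=
  Denumerable.mk' ⟨FO.encodeFO, FO.ofNatFO, FO.ofNatFO_encodeFO, FO.encodeFO_ofNatFO⟩

/-- The decision problem with the set of inputs `S` and the question `P` is decidable: there is an
algorithm that halts on every input `a ∈ S` and answers correctly whether `P a` holds.  (On other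
inputs the algorithm may do anything.) -/
def DecidableOn {α : Type} [Primcodable α] (S : Set α) (P : α → Prop) : Prop :=
  ∃ f : α →. Bool, Partrec f ∧ ∀ a ∈ S, ∃ b ∈ f a, (b = true ↔ P a)

/-- The fragment `F` of first-order logic is decidable: it is decidable whether `φ ⊨ ψ`, for
given formulas `φ, ψ ∈ F`. -/
def DecidableFragment (F : Set FO) : Prop :=
  DecidableOn (F ×ˢ F) (fun p : FO × FO => p.1.Entails p.2)

end ModalDefinability

/-! Let `φ` have quantifier rank at most `q`, with predicate symbols of index below `k`, and let `χ`
be a modal formula equivalent to `φ`. Its depth is not known in advance, but its truth depends only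
on the first-order type of rank `q` of a pointed model. Modal formulas do not distinguish a pointed
model from its unravelling, which is a rooted sum of smaller unravellings, and the type of a rooted
sum is determined by the types of its members. Hence the pairs of types realized by `n`-round
bisimilar models are given by the `n`-th iterate of a monotone operator on sets of pairs of types.
The iterates decrease, so they are constant from the step `N` on, where `N` is the number of all
pairs of types. If `n` is above its depth, `χ` takes equal values on the two types of a pair from
the `n`-th iterate, hence also on those from the `N`-th: it is invariant under bisimilarity in `N`
rounds. It is therefore equivalent to a member of a finite list of formulas that is computed from
`k` and `N`, and the decision procedure of the fragment tests each member of the list for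
equivalence to `φ`. -/

namespace ModalDefinability

/-! ## Pointed models and bounded bisimilarity -/

/-- Pointed Kripke models, the structures in which modal formulas are evaluated. -/
structure PointedModel : Type 1 where
  /-- The set of worlds. -/
  W : Type
  /-- The accessibility relation. -/
  R : W → W → Prop
  /-- The valuation of the propositional variables. -/
  V : ℕ → W → Prop
  /-- The distinguished world. -/
  pt : W

namespace PointedModel

/-- The same model with another distinguished world. -/
abbrev moveTo (M : PointedModel) (w : M.W) : PointedModel := { M with pt := w }

/-- The reduct to the propositional variables with index below `k`: the other variables become
false everywhere. -/
abbrev restrict (M : PointedModel) (k : ℕ) : PointedModel :=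
  { M with V := fun p w => p < k ∧ M.V p w }

/-- A pointed model as a first-order structure, in the signature of the standard translation; the
remaining predicate symbols denote empty relations. -/
abbrev toStruc (M : PointedModel) : Struc where
  dom := M.W
  nonempty := ⟨M.pt⟩
  rel i n := match n, i with
    | 1, i => fun a => M.V i (a 0)
    | 2, 0 => fun a => M.R (a 0) (a 1)
    | _, _ => fun _ => False

end PointedModel

/-- The pointed model that the standard translation sees in a first-order structure. -/
abbrev Struc.toPointedModel (A : Struc) (a : A.dom) : PointedModel where
  W := A.dom
  R b c := A.rel 0 2 ![b, c]
  V p b := A.rel p 1 ![b]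
  pt := a

/-- Truth of a modal formula at the distinguished world of a pointed model. -/
def ML.Sat : ML → PointedModel → Prop
  | .top, _ => True
  | .var p, M => M.V p M.pt
  | .and φ ψ, M => φ.Sat M ∧ ψ.Sat M
  | .not φ, M => ¬ φ.Sat M
  | .dia φ, M => ∃ w, M.R M.pt w ∧ φ.Sat (M.moveTo w)

theorem ML.sat_st {x y : ℕ} (hxy : x ≠ y) (χ : ML) (A : Struc) (v : ℕ → A.dom) :
    (χ.st x y).Sat A v ↔ χ.Sat (A.toPointedModel (v x)) := by
  induction χ generalizing x y v with
  | top => exact iff_of_true rfl trivial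
  | var p => exact iff_of_eq (congrArg (A.rel p 1) (List.ofFn_injective rfl))
  | and φ ψ ihφ ihψ => exact and_congr (ihφ hxy v) (ihψ hxy v)
  | not φ ih => exact not_congr (ih hxy v)
  | dia φ ih =>
    refine exists_congr fun b => and_congr ?_ ?_
    · refine iff_of_eq (congrArg (A.rel 0 2) (List.ofFn_injective ?_))
      simp [hxy]
    · simpa only [Function.update_self] using ih hxy.symm (Function.update v y b)

/-- Modal depth: the nesting of diamonds. -/
def ML.depth : ML → ℕ
  | .top => 0
  | .var _ => 0
  | .and φ ψ => max φ.depth ψ.depth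
  | .not φ => φ.depth
  | .dia φ => φ.depth + 1

/-- Bisimilarity with `n` rounds, for the propositional variables with index below `k`. No round
is needed to compare the distinguished worlds of arbitrary models, so `Bisim k n` preserves the
formulas of depth less than `n`. -/
def Bisim (k : ℕ) : ℕ → PointedModel → PointedModel → Prop
  | 0, _, _ => True
  | n + 1, M, N => (∀ p < k, M.V p M.pt ↔ N.V p N.pt) ∧
      (∀ w, M.R M.pt w → ∃ w', N.R N.pt w' ∧ Bisim k n (M.moveTo w) (N.moveTo w')) ∧
      (∀ w', N.R N.pt w' → ∃ w, M.R M.pt w ∧ Bisim k n (M.moveTo w) (N.moveTo w'))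

namespace Bisim

variable {k n : ℕ} {M N K : PointedModel}

@[refl]
theorem refl (k n : ℕ) (M : PointedModel) : Bisim k n M M := by
  induction n generalizing M with
  | zero => trivial
  | succ n ih =>
    exact ⟨fun _ _ => Iff.rfl, fun w h => ⟨w, h, ih _⟩, fun w h => ⟨w, h, ih _⟩⟩

@[symm]
theorem symm (h : Bisim k n M N) : Bisim k n N M := by
  induction n generalizing M N with
  | zero => trivial
  | succ n ih =>
    obtain ⟨hV, hforth, hback⟩ := h
    exact ⟨fun p hp => (hV p hp).symm, fun w hw => (hback w hw).imp fun _ h => ⟨h.1, ih h.2⟩,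
      fun w hw => (hforth w hw).imp fun _ h => ⟨h.1, ih h.2⟩⟩

@[trans]
theorem trans (h : Bisim k n M N) (h' : Bisim k n N K) : Bisim k n M K := by
  induction n generalizing M N K with
  | zero => trivial
  | succ n ih =>
    obtain ⟨hV, hforth, hback⟩ := h
    obtain ⟨hV', hforth', hback'⟩ := h'
    refine ⟨fun p hp => (hV p hp).trans (hV' p hp), fun w hw => ?_, fun w'' hw'' => ?_⟩
    · obtain ⟨w', hw', hb⟩ := hforth w hw
      obtain ⟨w'', hw'', hb'⟩ := hforth' w' hw'
      exact ⟨w'', hw'', ih hb hb'⟩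
    · obtain ⟨w', hw', hb'⟩ := hback' w'' hw''
      obtain ⟨w, hw, hb⟩ := hback w' hw'
      exact ⟨w, hw, ih hb hb'⟩

theorem sat_restrict_iff (h : Bisim k n M N) (χ : ML) (hχ : χ.depth < n) :
    χ.Sat (M.restrict k) ↔ χ.Sat (N.restrict k) := by
  obtain ⟨n, rfl⟩ := Nat.exists_eq_add_one_of_ne_zero (Nat.ne_zero_of_lt hχ)
  induction χ generalizing n M N with
  | top => exact Iff.rfl
  | var p => exact and_congr_right (h.1 p)
  | and φ ψ ihφ ihψ =>
    obtain ⟨hφ, hψ⟩ := max_lt_iff.1 hχ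
    exact and_congr (ihφ n h hφ) (ihψ n h hψ)
  | not φ ih => exact not_congr (ih n h hχ)
  | dia φ ih =>
    obtain ⟨m, rfl⟩ := Nat.exists_eq_add_one_of_ne_zero (n := n) (by grind [ML.depth])
    have hφ : φ.depth < m + 1 := Nat.lt_of_succ_lt_succ hχ
    constructor
    · rintro ⟨w, hw, hsat⟩
      obtain ⟨w', hw', hb⟩ := h.2.1 w hw
      exact ⟨w', hw', (ih m hb hφ).1 hsat⟩
    · rintro ⟨w', hw', hsat⟩
      obtain ⟨w, hw, hb⟩ := h.2.2 w' hw'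
      exact ⟨w, hw, (ih m hb hφ).2 hsat⟩

end Bisim

/-! ## First-order types of bounded quantifier rank -/

/-- The possible types of quantifier rank `q` of `m`-tuples, with respect to equality, the
accessibility relation and `k` propositional variables: the atomic type of the tuple for `q = 0`,
and the set of types of its one-point extensions for `q + 1`. -/
def Ty (k : ℕ) : ℕ → ℕ → Type
  | 0, m => (Fin m → Fin m → Prop) × (Fin m → Fin m → Prop) × (Fin k → Fin m → Prop)
  | q + 1, m => Set (Ty k q (m + 1))

instance Ty.instFinite (k q m : ℕ) : Finite (Ty k q m) := by
  induction q generalizing m with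
  | zero => unfold Ty; infer_instance
  | succ q ih => have := ih (m + 1); unfold Ty; infer_instance

/-- The cardinality of `Ty k q m`, in a form that is visibly primitive recursive. -/
def tyCard (k q m : ℕ) : ℕ :=
  (2 ^ ·)^[q] (2 ^ (2 * (m + q) ^ 2 + k * (m + q)))

theorem card_ty (k q m : ℕ) : Nat.card (Ty k q m) = tyCard k q m := by
  have card_prop : Nat.card Prop = 2 := by simp
  induction q generalizing m with
  | zero =>
    simp only [Ty, tyCard, Nat.card_prod, Nat.card_fun, Nat.card_fin, card_prop, ← pow_mul,
      ← pow_add, Function.iterate_zero, id, Nat.add_zero]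
    ring_nf
  | succ q ih =>
    calc Nat.card (Ty k q (m + 1) → Prop) = 2 ^ tyCard k q (m + 1) := by
          rw [Nat.card_fun, card_prop, ih]
      _ = tyCard k (q + 1) m := by
          simp only [tyCard, Function.iterate_succ_apply', Nat.add_right_comm m 1 q,
            ← Nat.add_assoc]

open Matrix (vecCons)

/-- The type of quantifier rank `q` of a tuple of worlds. -/
def tp (k : ℕ) : (q : ℕ) → (M : PointedModel) → {m : ℕ} → (Fin m → M.W) → Ty k q m
  | 0, M, _, u => (fun i j => u i = u j, fun i j => M.R (u i) (u j), fun p j => M.V p (u j))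
  | q + 1, M, _, u => Set.range fun a => tp k q M (vecCons a u)

section Types

variable {k q m : ℕ} {M N : PointedModel} {u : Fin m → M.W} {w : Fin m → N.W}

theorem tp_zero_iff : tp k 0 M u = tp k 0 N w ↔ (∀ i j, u i = u j ↔ w i = w j) ∧
    (∀ i j, M.R (u i) (u j) ↔ N.R (w i) (w j)) ∧ (∀ p < k, ∀ j, M.V p (u j) ↔ N.V p (w j)) := by
  refine Prod.ext_iff.trans (and_congr ?_ (Prod.ext_iff.trans (and_congr ?_ ?_)))
  · simp only [tp, funext_iff, eq_iff_iff]
  · simp only [tp, funext_iff, eq_iff_iff]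
  · simp only [tp, funext_iff, eq_iff_iff, Fin.forall_iff (n := k)]

theorem tp_succ_iff : tp k (q + 1) M u = tp k (q + 1) N w ↔
    (∀ a, ∃ b, tp k q M (vecCons a u) = tp k q N (vecCons b w)) ∧
      (∀ b, ∃ a, tp k q M (vecCons a u) = tp k q N (vecCons b w)) := by
  refine Set.Subset.antisymm_iff.trans (and_congr ?_ ?_)
  · simp only [tp, Set.range_subset_iff, Set.mem_range, eq_comm]
  · simp only [tp, Set.range_subset_iff, Set.mem_range]

theorem tp_zero_of_tp (h : tp k q M u = tp k q N w) : tp k 0 M u = tp k 0 N w := by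
  induction q generalizing m with
  | zero => exact h
  | succ q ih =>
    obtain ⟨b, hb⟩ := (tp_succ_iff.1 h).1 M.pt
    obtain ⟨hEq, hR, hV⟩ := tp_zero_iff.1 (ih hb)
    exact tp_zero_iff.2 ⟨fun i j => hEq i.succ j.succ, fun i j => hR i.succ j.succ,
      fun p hp j => hV p hp j.succ⟩

/-- The answer to a choice inside the tuple is forced by the equalities that types record. -/
theorem tp_vecCons_self (h : tp k (q + 1) M u = tp k (q + 1) N w) (j : Fin m) :
    tp k q M (vecCons (u j) u) = tp k q N (vecCons (w j) w) := by
  obtain ⟨b, hb⟩ := (tp_succ_iff.1 h).1 (u j)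
  obtain rfl : b = w j := ((tp_zero_iff.1 (tp_zero_of_tp hb)).1 0 j.succ).1 rfl
  exact hb

theorem tp_restrict (k q : ℕ) (M : PointedModel) (u : Fin m → M.W) :
    tp k q (M.restrict k) u = tp k q M u := by
  induction q generalizing m with
  | zero =>
    exact tp_zero_iff.2 ⟨fun _ _ => Iff.rfl, fun _ _ => Iff.rfl, fun _ hp _ => and_iff_right hp⟩
  | succ q ih => exact congrArg Set.range (funext fun a => ih (vecCons a u))

end Types

/-- The type of the distinguished world. -/
abbrev PointedModel.type (k q : ℕ) (M : PointedModel) : Ty k q 1 := tp k q M fun _ => M.pt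

namespace FO

/-- Quantifier rank: the nesting of quantifiers. -/
def qr : FO → ℕ
  | .top => 0
  | .rel _ _ => 0
  | .eq _ _ => 0
  | .and φ ψ => max φ.qr ψ.qr
  | .not φ => φ.qr
  | .ex _ φ => φ.qr + 1

/-- The least strict upper bound of the indices of the predicate symbols of a formula. -/
def symBound : FO → ℕ
  | .top => 0
  | .rel i _ => i + 1
  | .eq _ _ => 0
  | .and φ ψ => max φ.symBound ψ.symBound
  | .not φ => φ.symBound
  | .ex _ φ => φ.symBound

theorem qr_le_encodeFO (φ : FO) : φ.qr ≤ φ.encodeFO := by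
  induction φ with
  | top | rel | eq => exact Nat.zero_le _
  | and φ ψ ihφ ihψ => grind [qr, encodeFO, Nat.left_le_pair, Nat.right_le_pair]
  | not φ ih => grind [qr, encodeFO]
  | ex x φ ih => grind [qr, encodeFO, Nat.right_le_pair]

theorem symBound_le_encodeFO (φ : FO) : φ.symBound ≤ φ.encodeFO := by
  induction φ with
  | top | eq => exact Nat.zero_le _
  | rel i args => grind [symBound, encodeFO, Nat.left_le_pair]
  | and φ ψ ihφ ihψ => grind [symBound, encodeFO, Nat.left_le_pair, Nat.right_le_pair]
  | not φ ih => grind [symBound, encodeFO]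
  | ex x φ ih => grind [symBound, encodeFO, Nat.right_le_pair]

variable {k q m : ℕ} {M N : PointedModel} {u : Fin m → M.W} {w : Fin m → N.W}

theorem sat_rel_iff_of_tp_zero (h : tp k 0 M u = tp k 0 N w) {i : ℕ} (hi : i < k) (args : List ℕ)
    (ρ : ℕ → Fin m) :
    (rel i args).Sat M.toStruc (fun x => u (ρ x)) ↔
      (rel i args).Sat N.toStruc (fun x => w (ρ x)) := by
  obtain ⟨-, hR, hV⟩ := tp_zero_iff.1 h
  match args, i with
  | [], _ => exact Iff.rfl
  | [x], i => exact hV i hi (ρ x)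
  | [x, y], 0 => exact hR (ρ x) (ρ y)
  | [_, _], _ + 1 => exact Iff.rfl
  | _ :: _ :: _ :: _, _ => exact Iff.rfl

theorem sat_ex_iff (u : Fin m → M.W) (ρ : ℕ → Fin m) (x : ℕ) (φ : FO) :
    (ex x φ).Sat M.toStruc (fun y => u (ρ y)) ↔ ∃ a, φ.Sat M.toStruc
      fun y => vecCons a u (Function.update (fun z => (ρ z).succ) x 0 y) := by
  refine exists_congr fun a => iff_of_eq (congrArg (φ.Sat M.toStruc) (funext fun y => ?_))
  obtain rfl | hy := eq_or_ne y x <;> simp [*]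

theorem sat_iff_of_tp (h : tp k q M u = tp k q N w) (φ : FO) (hk : φ.symBound ≤ k)
    (hq : φ.qr ≤ q) (ρ : ℕ → Fin m) :
    φ.Sat M.toStruc (fun x => u (ρ x)) ↔ φ.Sat N.toStruc (fun x => w (ρ x)) := by
  induction φ generalizing q m with
  | top => exact Iff.rfl
  | rel i args => exact sat_rel_iff_of_tp_zero (tp_zero_of_tp h) hk args ρ
  | eq x y => exact (tp_zero_iff.1 (tp_zero_of_tp h)).1 (ρ x) (ρ y)
  | and φ ψ ihφ ihψ =>
    obtain ⟨hkφ, hkψ⟩ := max_le_iff.1 hk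
    obtain ⟨hqφ, hqψ⟩ := max_le_iff.1 hq
    exact and_congr (ihφ h hkφ hqφ ρ) (ihψ h hkψ hqψ ρ)
  | not φ ih => exact not_congr (ih h hk hq ρ)
  | ex x φ ih =>
    obtain ⟨q, rfl⟩ := Nat.exists_eq_add_one_of_ne_zero (n := q) (by grind [qr])
    have hφ : φ.qr ≤ q := Nat.le_of_succ_le_succ hq
    obtain ⟨forth, back⟩ := tp_succ_iff.1 h
    rw [sat_ex_iff, sat_ex_iff]
    constructor
    · rintro ⟨a, ha⟩
      obtain ⟨b, hab⟩ := forth a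
      exact ⟨b, (ih hab hk hφ _).1 ha⟩
    · rintro ⟨b, hb⟩
      obtain ⟨a, hab⟩ := back b
      exact ⟨a, (ih hab hk hφ _).2 hb⟩

end FO

/-! ## Rooted sums -/

/-- Worlds of the rooted sum of the family `X`: a new root `none` and the worlds of the members of
the family. -/
abbrev RootedSum {I : Type} (X : I → PointedModel) : Type := Option (Σ i, (X i).W)

/-- Accessibility in the rooted sum: from the root to the distinguished worlds, and inside each of
the members of the family. -/
inductive RootedSum.Acc {I : Type} (X : I → PointedModel) : RootedSum X → RootedSum X → Prop
  | root (i : I) : Acc X none (some ⟨i, (X i).pt⟩)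
  | step {i : I} {z z' : (X i).W} (h : (X i).R z z') : Acc X (some ⟨i, z⟩) (some ⟨i, z'⟩)

/-- The valuation of the rooted sum: the variables in `l` are true at the root. -/
def RootedSum.Val {I : Type} {X : I → PointedModel} (l : ℕ → Prop) (p : ℕ) : RootedSum X → Prop
  | none => l p
  | some ⟨i, z⟩ => (X i).V p z

/-- The disjoint union of the family `X` together with a new distinguished root, where exactly the
propositional variables in `l` are true and from which the distinguished worlds are accessible. -/
abbrev rootedSum {I : Type} (l : ℕ → Prop) (X : I → PointedModel) : PointedModel where
  W := RootedSum X
  R := RootedSum.Acc X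
  V := RootedSum.Val l
  pt := none

section RootedSum

variable {I : Type} {l : ℕ → Prop} {X Y : I → PointedModel} {k q n : ℕ}

namespace RootedSum

/-- The member of the family to which a world belongs, `none` for the root. -/
def index (e : RootedSum X) : Option I := e.map Sigma.fst

open Classical in
/-- The projection to the members of the family that maps everything outside of a member to its
distinguished world. -/
noncomputable def coord : RootedSum X → ∀ i, (X i).W
  | none => fun i => (X i).pt
  | some ⟨j, z⟩ => Function.update (fun i => (X i).pt) j z

@[simp]
theorem coord_none (i : I) : coord (none : RootedSum X) i = (X i).pt := rfl

@[simp]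
theorem coord_some_self (i : I) (z : (X i).W) : coord (some ⟨i, z⟩ : RootedSum X) i = z := by
  simp [coord]

theorem coord_some_of_ne {i j : I} (hij : i ≠ j) (z : (X j).W) :
    coord (some ⟨j, z⟩ : RootedSum X) i = (X i).pt := by
  simp [coord, hij]

theorem eq_iff_index_coord {e e' : RootedSum X} :
    e = e' ↔ index e = index e' ∧ ∀ i, coord e i = coord e' i := by
  refine ⟨fun h => h ▸ ⟨rfl, fun _ => rfl⟩, fun ⟨hidx, hcoord⟩ => ?_⟩
  match e, e' with
  | none, none => rfl
  | some ⟨i, z⟩, some ⟨j, z'⟩ =>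
    obtain rfl : i = j := Option.some.inj hidx
    simpa using hcoord i

theorem acc_iff_index_coord {e e' : RootedSum X} :
    Acc X e e' ↔ ∃ i, index e' = some i ∧
      ((index e = none ∧ coord e' i = (X i).pt) ∨
        (index e = some i ∧ (X i).R (coord e i) (coord e' i))) := by
  constructor
  · rintro (i | @⟨i, z, z', h⟩)
    · exact ⟨i, rfl, .inl ⟨rfl, coord_some_self ..⟩⟩
    · exact ⟨i, rfl, .inr ⟨rfl, by simpa using h⟩⟩
  · rintro ⟨i, hi', h⟩
    match e, e' with
    | e, some ⟨j', z'⟩ =>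
      obtain rfl : j' = i := Option.some.inj hi'
      rw [coord_some_self] at h
      match e, h with
      | none, .inl ⟨_, h⟩ => exact h ▸ .root j'
      | some ⟨j, z⟩, .inr ⟨hj, h⟩ =>
        obtain rfl : j = j' := Option.some.inj hj
        exact .step (by simpa using h)

theorem val_iff_index_coord {p : ℕ} {e : RootedSum X} :
    Val l p e ↔ (index e = none ∧ l p) ∨
      ∃ i, index e = some i ∧ (X i).V p (coord e i) := by
  match e with
  | none => simp [Val, index]
  | some ⟨i, z⟩ => simp [Val, index]

end RootedSum

open RootedSum
open Matrix (vecCons)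

section Types

variable {m : ℕ} {u : Fin m → RootedSum X} {w : Fin m → RootedSum Y} {j₀ : Fin m}

theorem tp_zero_rootedSum (hu : u j₀ = none) (hw : w j₀ = none)
    (hidx : ∀ j, index (u j) = index (w j))
    (h : ∀ i, tp k 0 (X i) (fun j => coord (u j) i) = tp k 0 (Y i) (fun j => coord (w j) i)) :
    tp k 0 (rootedSum l X) u = tp k 0 (rootedSum l Y) w := by
  simp only [tp_zero_iff] at h
  have hpt (i : I) (j : Fin m) : coord (u j) i = (X i).pt ↔ coord (w j) i = (Y i).pt := by
    simpa only [hu, hw, coord_none] using (h i).1 j j₀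
  refine tp_zero_iff.2 ⟨fun j j' => ?_, fun j j' => ?_, fun p hp j => ?_⟩
  · simp only [eq_iff_index_coord, hidx, (h _).1 j j']
  · simp only [acc_iff_index_coord, hidx, hpt, (h _).2.1 j j']
  · simp only [val_iff_index_coord, hidx, (h _).2.2 p hp j]

/-- One round of the Ehrenfeucht-Fraïssé game on rooted sums: a choice inside one member of the
family is answered there, and counts in the other members as the choice of the distinguished
world. -/
theorem exists_tp_vecCons_coord_eq (hu : u j₀ = none) (hw : w j₀ = none)
    (h : ∀ i, tp k (q + 1) (X i) (fun j => coord (u j) i) =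
      tp k (q + 1) (Y i) (fun j => coord (w j) i)) (e : RootedSum X) :
    ∃ e' : RootedSum Y, index e = index e' ∧
      ∀ i, tp k q (X i) (vecCons (coord e i) fun j => coord (u j) i) =
        tp k q (Y i) (vecCons (coord e' i) fun j => coord (w j) i) := by
  have hpt (i : I) : tp k q (X i) (vecCons (X i).pt fun j => coord (u j) i) =
      tp k q (Y i) (vecCons (Y i).pt fun j => coord (w j) i) := by
    simpa only [hu, hw, coord_none] using tp_vecCons_self (h i) j₀
  match e with
  | none => exact ⟨none, rfl, hpt⟩
  | some ⟨j, z⟩ =>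
    obtain ⟨z', hz'⟩ := (tp_succ_iff.1 (h j)).1 z
    refine ⟨some ⟨j, z'⟩, rfl, fun i => ?_⟩
    obtain rfl | hij := eq_or_ne i j
    · rwa [coord_some_self, coord_some_self]
    · rw [coord_some_of_ne hij, coord_some_of_ne hij]
      exact hpt i

theorem coord_vecCons (e : RootedSum X) (u : Fin m → RootedSum X) (i : I) :
    (fun j => coord (vecCons e u j) i) = vecCons (coord e i) fun j => coord (u j) i :=
  funext <| Fin.cases rfl fun _ => rfl

theorem tp_rootedSum (hu : u j₀ = none) (hw : w j₀ = none)
    (hidx : ∀ j, index (u j) = index (w j))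
    (h : ∀ i, tp k q (X i) (fun j => coord (u j) i) = tp k q (Y i) (fun j => coord (w j) i)) :
    tp k q (rootedSum l X) u = tp k q (rootedSum l Y) w := by
  induction q generalizing m with
  | zero => exact tp_zero_rootedSum hu hw hidx h
  | succ q ih =>
    refine tp_succ_iff.2 ⟨fun e => ?_, fun e' => ?_⟩
    · obtain ⟨e', hidx', htp⟩ := exists_tp_vecCons_coord_eq hu hw h e
      exact ⟨e', ih (j₀ := j₀.succ) hu hw (Fin.cases hidx' hidx)
        fun i => by simpa only [coord_vecCons] using htp i⟩
    · obtain ⟨e, hidx', htp⟩ := exists_tp_vecCons_coord_eq hw hu (fun i => (h i).symm) e'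
      exact ⟨e, ih (j₀ := j₀.succ) hu hw (Fin.cases hidx'.symm hidx)
        fun i => by simpa only [coord_vecCons] using (htp i).symm⟩

theorem type_rootedSum (h : ∀ i, (X i).type k q = (Y i).type k q) :
    (rootedSum l X).type k q = (rootedSum l Y).type k q :=
  tp_rootedSum (j₀ := 0) rfl rfl (fun _ => rfl) h

end Types

theorem bisim_moveTo_some (k n : ℕ) (i : I) (z : (X i).W) :
    Bisim k n ((X i).moveTo z) ((rootedSum l X).moveTo (some ⟨i, z⟩)) := by
  induction n generalizing z with
  | zero => trivial
  | succ n ih =>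
    refine ⟨fun _ _ => Iff.rfl, fun z' h => ⟨some ⟨i, z'⟩, .step h, ih z'⟩, ?_⟩
    rintro _ (_ | h)
    exact ⟨_, h, ih _⟩

theorem bisim_rootedSum_of_successors {M : PointedModel} (s : I → M.W)
    (hs : ∀ w, M.R M.pt w ↔ ∃ i, s i = w) (hl : ∀ p < k, M.V p M.pt ↔ l p)
    (h : ∀ i, Bisim k n (M.moveTo (s i)) (X i)) : Bisim k (n + 1) M (rootedSum l X) := by
  refine ⟨hl, fun w hw => ?_, ?_⟩
  · obtain ⟨i, rfl⟩ := (hs w).1 hw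
    exact ⟨_, .root i, (h i).trans (bisim_moveTo_some k n i _)⟩
  · rintro _ (i | _)
    exact ⟨s i, (hs _).2 ⟨i, rfl⟩, (h i).trans (bisim_moveTo_some k n i _)⟩

theorem bisim_rootedSum (h : ∀ i, Bisim k n (X i) (Y i)) :
    Bisim k (n + 1) (rootedSum l X) (rootedSum l Y) :=
  bisim_rootedSum_of_successors (fun i => some ⟨i, (X i).pt⟩)
    (fun _ => ⟨fun | .root i => ⟨i, rfl⟩, fun ⟨i, hi⟩ => hi ▸ .root i⟩) (fun _ _ => Iff.rfl)
    fun i => (bisim_moveTo_some k n i _).symm.trans (h i)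

end RootedSum

/-! ## Pairs of types realized by bisimilar models -/

/-- The pairs of types of rooted sums of two families whose members realize pairs in `D`. -/
def sumPairs (k q : ℕ) (D : Set (Ty k q 1 × Ty k q 1)) : Set (Ty k q 1 × Ty k q 1) :=
  {t | ∃ (I : Type) (l : ℕ → Prop) (X Y : I → PointedModel),
    (∀ i, ((X i).type k q, (Y i).type k q) ∈ D) ∧
    t = ((rootedSum l X).type k q, (rootedSum l Y).type k q)}

/-- The pairs of types realized by rooted sums nested `n`-fold; up to replacing models by fully
bisimilar ones, these are the pairs of types realized by pairs of models in `Bisim k n`. -/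
def pairs (k q n : ℕ) : Set (Ty k q 1 × Ty k q 1) :=
  (sumPairs k q)^[n] (Set.range (PointedModel.type k q) ×ˢ Set.range (PointedModel.type k q))

theorem sumPairs_mono (k q : ℕ) : Monotone (sumPairs k q) := by
  rintro D D' hD _ ⟨I, l, X, Y, hXY, rfl⟩
  exact ⟨I, l, X, Y, fun i => hD (hXY i), rfl⟩

theorem sumPairs_subset_range_prod (k q : ℕ) (D : Set (Ty k q 1 × Ty k q 1)) :
    sumPairs k q D ⊆ Set.range (PointedModel.type k q) ×ˢ Set.range (PointedModel.type k q) := by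
  rintro _ ⟨I, l, X, Y, -, rfl⟩
  exact ⟨⟨_, rfl⟩, ⟨_, rfl⟩⟩

theorem pairs_succ (k q n : ℕ) : pairs k q (n + 1) = sumPairs k q (pairs k q n) :=
  Function.iterate_succ_apply' ..

theorem exists_bisim_of_mem_pairs {k q n : ℕ} {t : Ty k q 1 × Ty k q 1} (ht : t ∈ pairs k q n) :
    ∃ M N : PointedModel, Bisim k n M N ∧ (M.type k q, N.type k q) = t := by
  induction n generalizing t with
  | zero =>
    obtain ⟨⟨M, hM⟩, N, hN⟩ := ht
    exact ⟨M, N, trivial, Prod.ext hM hN⟩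
  | succ n ih =>
    rw [pairs_succ] at ht
    obtain ⟨I, l, X, Y, hXY, rfl⟩ := ht
    choose X' Y' hbisim htype using fun i => ih (hXY i)
    exact ⟨rootedSum l X', rootedSum l Y', bisim_rootedSum hbisim,
      Prod.ext (type_rootedSum fun i => congrArg Prod.fst (htype i))
        (type_rootedSum fun i => congrArg Prod.snd (htype i))⟩

/-- Unravelling `n` levels synchronously turns models related by `Bisim k n` into nested rooted
sums. -/
theorem exists_type_mem_pairs_of_bisim {k n : ℕ} (q : ℕ) {M N : PointedModel} (h : Bisim k n M N) :
    ∃ M' N' : PointedModel, (∀ m, Bisim k m M M') ∧ (∀ m, Bisim k m N N') ∧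
      (M'.type k q, N'.type k q) ∈ pairs k q n := by
  induction n generalizing M N with
  | zero => exact ⟨M, N, fun m => .refl k m M, fun m => .refl k m N, ⟨M, rfl⟩, N, rfl⟩
  | succ n ih =>
    obtain ⟨hV, hforth, hback⟩ := h
    let I := {s : M.W × N.W //
      M.R M.pt s.1 ∧ N.R N.pt s.2 ∧ Bisim k n (M.moveTo s.1) (N.moveTo s.2)}
    choose X Y hX hY hXY using fun s : I => ih s.2.2.2
    have hM (w : M.W) : M.R M.pt w ↔ ∃ s : I, s.1.1 = w := by
      refine ⟨fun hw => ?_, fun ⟨s, hs⟩ => hs ▸ s.2.1⟩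
      obtain ⟨w', hw', hb⟩ := hforth w hw
      exact ⟨⟨(w, w'), hw, hw', hb⟩, rfl⟩
    have hN (w' : N.W) : N.R N.pt w' ↔ ∃ s : I, s.1.2 = w' := by
      refine ⟨fun hw' => ?_, fun ⟨s, hs⟩ => hs ▸ s.2.2.1⟩
      obtain ⟨w, hw, hb⟩ := hback w' hw'
      exact ⟨⟨(w, w'), hw, hw', hb⟩, rfl⟩
    refine ⟨rootedSum (M.V · M.pt) X, rootedSum (M.V · M.pt) Y, fun m => ?_, fun m => ?_, ?_⟩
    · cases m with
      | zero => trivial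
      | succ m => exact bisim_rootedSum_of_successors _ hM (fun _ _ => Iff.rfl) fun s => hX s m
    · cases m with
      | zero => trivial
      | succ m =>
        exact bisim_rootedSum_of_successors _ hN (fun p hp => (hV p hp).symm) fun s => hY s m
    · rw [pairs_succ]
      exact ⟨I, _, X, Y, hXY, rfl⟩

/-- A decreasing orbit of sets can shrink only as often as there are elements. -/
theorem iterate_card_subset_iterate {α : Type*} [Finite α] {Φ : Set α → Set α} (hΦ : Monotone Φ)
    {s : Set α} (hs : Φ s ⊆ s) (n : ℕ) : Φ^[Nat.card α] s ⊆ Φ^[n] s := by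
  have hanti : Antitone fun n => Φ^[n] s := hΦ.antitone_iterate_of_map_le hs
  have hcard_eq {m m' : ℕ} (hm : m ≤ m') (h : (Φ^[m] s)ᶜ.ncard = (Φ^[m'] s)ᶜ.ncard) :
      Φ^[m] s = Φ^[m'] s :=
    compl_injective (Set.eq_of_subset_of_ncard_le (Set.compl_subset_compl.2 (hanti hm)) h.ge)
  obtain hn | hn := le_total n (Nat.card α)
  · exact hanti hn
  refine (hcard_eq hn (Nat.stabilises_of_monotone (f := fun m => (Φ^[m] s)ᶜ.ncard)
    (fun m m' hm => Set.ncard_le_ncard (Set.compl_subset_compl.2 (hanti hm)))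
    (fun m => Set.ncard_le_card _) (fun m hm => ?_) hn).symm).subset
  have hfix := hcard_eq m.le_succ hm
  simp only [Function.iterate_succ_apply'] at hfix ⊢
  rw [← hfix, ← hfix]

/-- The number of rounds after which `pairs k q` has stabilised. -/
def depthBound (k q : ℕ) : ℕ := tyCard k q 1 * tyCard k q 1

theorem pairs_depthBound_subset (k q n : ℕ) : pairs k q (depthBound k q) ⊆ pairs k q n := by
  have hcard : Nat.card (Ty k q 1 × Ty k q 1) = depthBound k q := by
    rw [Nat.card_prod, card_ty, depthBound]
  exact hcard ▸ iterate_card_subset_iterate (sumPairs_mono k q) (sumPairs_subset_range_prod k q _) n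

namespace ML

/-- The modal formula is invariant under equality of types of quantifier rank `q`; this holds if it
is equivalent to a first-order formula of quantifier rank at most `q`. -/
def TypeInvariant (k q : ℕ) (χ : ML) : Prop :=
  ∀ M N : PointedModel, M.type k q = N.type k q → (χ.Sat M ↔ χ.Sat N)

variable {k q : ℕ} {χ : ML} {M N : PointedModel}

theorem TypeInvariant.sat_restrict_iff (hχ : χ.TypeInvariant k q) (M : PointedModel) :
    χ.Sat (M.restrict k) ↔ χ.Sat M :=
  hχ _ _ (tp_restrict k q M _)

theorem TypeInvariant.sat_iff_of_bisim_depth_succ (hχ : χ.TypeInvariant k q)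
    (h : Bisim k (χ.depth + 1) M N) : χ.Sat M ↔ χ.Sat N := by
  rw [← hχ.sat_restrict_iff M, ← hχ.sat_restrict_iff N]
  exact h.sat_restrict_iff χ (Nat.lt_succ_self _)

theorem TypeInvariant.sat_iff_of_bisim (hχ : χ.TypeInvariant k q)
    (h : Bisim k (depthBound k q) M N) : χ.Sat M ↔ χ.Sat N := by
  obtain ⟨M₁, N₁, hM, hN, hmem⟩ := exists_type_mem_pairs_of_bisim q h
  obtain ⟨M₂, N₂, hbisim, htype⟩ :=
    exists_bisim_of_mem_pairs (pairs_depthBound_subset k q (χ.depth + 1) hmem)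
  calc χ.Sat M ↔ χ.Sat M₁ := hχ.sat_iff_of_bisim_depth_succ (hM _)
    _ ↔ χ.Sat M₂ := hχ _ _ (congrArg Prod.fst htype).symm
    _ ↔ χ.Sat N₂ := hχ.sat_iff_of_bisim_depth_succ hbisim
    _ ↔ χ.Sat N₁ := hχ _ _ (congrArg Prod.snd htype)
    _ ↔ χ.Sat N := (hχ.sat_iff_of_bisim_depth_succ (hN _)).symm

theorem typeInvariant_of_sat_iff {x y : ℕ} (hxy : x ≠ y) {φ : FO} (hk : φ.symBound ≤ k)
    (hq : φ.qr ≤ q) (h : ∀ (A : Struc) (v : ℕ → A.dom), φ.Sat A v ↔ (χ.st x y).Sat A v) :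
    χ.TypeInvariant k q := by
  have hφ (M : PointedModel) : φ.Sat M.toStruc (fun _ => M.pt) ↔ χ.Sat M :=
    (h M.toStruc fun _ => M.pt).trans (sat_st hxy χ M.toStruc _)
  intro M N htype
  rw [← hφ M, ← hφ N]
  exact FO.sat_iff_of_tp htype φ hk hq fun _ => 0

end ML

/-! ## Representatives of the modal formulas of bounded depth -/

/-- All decision trees that run through the list of tests in order, where `branch t β γ` continues
with `β` if the test `t` succeeds and with `γ` otherwise. -/
def decisionTrees {α : Type*} (branch : α → α → α → α) (leaves tests : List α) : List α :=
  tests.foldr (fun t trees => trees.flatMap fun β => trees.map (branch t β)) leaves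

theorem map_decisionTrees {α β : Type*} (f : α → β) {branch : α → α → α → α}
    {branch' : β → β → β → β} (hf : ∀ t b c, f (branch t b c) = branch' (f t) (f b) (f c))
    (leaves tests : List α) : (decisionTrees branch leaves tests).map f =
      decisionTrees branch' (leaves.map f) (tests.map f) := by
  induction tests with
  | nil => rfl
  | cons t tests ih =>
    have hcomp (b : α) : f ∘ branch t b = branch' (f t) (f b) ∘ f := funext (hf t b)
    simp only [decisionTrees, List.map_cons, List.foldr_cons] at ih ⊢
    simp only [← ih, List.map_flatMap, List.flatMap_map, List.map_map, hcomp]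

namespace ML

/-- The modal formula that agrees with `β` where `α` is true and with `γ` where it is false. -/
def branch (α β γ : ML) : ML := .not (.and (.not (.and α β)) (.not (.and (.not α) γ)))

theorem sat_branch_iff_of_sat {α β γ : ML} {M : PointedModel} (h : α.Sat M) :
    (branch α β γ).Sat M ↔ β.Sat M := by
  simp [branch, Sat, h]

theorem sat_branch_iff_of_not_sat {α β γ : ML} {M : PointedModel} (h : ¬ α.Sat M) :
    (branch α β γ).Sat M ↔ γ.Sat M := by
  simp [branch, Sat, h]

/-- Representatives of the Boolean combinations of the given formulas. -/
def boolCombs (tests : List ML) : List ML := decisionTrees branch [.top, .not .top] tests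

theorem mem_boolCombs_cons {α : ML} {tests : List ML} {χ : ML} : χ ∈ boolCombs (α :: tests) ↔
    ∃ β ∈ boolCombs tests, ∃ γ ∈ boolCombs tests, branch α β γ = χ := by
  simp only [boolCombs, decisionTrees, List.foldr_cons, List.mem_flatMap, List.mem_map]

theorem exists_mem_boolCombs (tests : List ML) (C P : PointedModel → Prop)
    (hP : ∀ M N, C M → C N → (∀ α ∈ tests, α.Sat M ↔ α.Sat N) → (P M ↔ P N)) :
    ∃ χ ∈ boolCombs tests, ∀ M, C M → (χ.Sat M ↔ P M) := by
  induction tests generalizing C with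
  | nil =>
    by_cases h : ∃ M, C M ∧ P M
    · obtain ⟨M, hM, hPM⟩ := h
      exact ⟨.top, by simp [boolCombs, decisionTrees],
        fun N hN => iff_of_true trivial ((hP M N hM hN (by simp)).1 hPM)⟩
    · exact ⟨.not .top, by simp [boolCombs, decisionTrees],
        fun N hN => iff_of_false (fun h => h trivial) fun hPN => h ⟨N, hN, hPN⟩⟩
  | cons α tests ih =>
    obtain ⟨β, hβ, hβP⟩ := ih (fun M => C M ∧ α.Sat M) fun M N hM hN h =>
      hP M N hM.1 hN.1 (List.forall_mem_cons.2 ⟨iff_of_true hM.2 hN.2, h⟩)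
    obtain ⟨γ, hγ, hγP⟩ := ih (fun M => C M ∧ ¬ α.Sat M) fun M N hM hN h =>
      hP M N hM.1 hN.1 (List.forall_mem_cons.2 ⟨iff_of_false hM.2 hN.2, h⟩)
    refine ⟨branch α β γ, mem_boolCombs_cons.2 ⟨β, hβ, γ, hγ, rfl⟩, fun M hM => ?_⟩
    by_cases hα : α.Sat M
    · exact (sat_branch_iff_of_sat hα).trans (hβP M ⟨hM, hα⟩)
    · exact (sat_branch_iff_of_not_sat hα).trans (hγP M ⟨hM, hα⟩)

/-- Representatives of the properties of pointed models that are invariant under `Bisim k n`. -/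
def level (k : ℕ) : ℕ → List ML
  | 0 => boolCombs []
  | n + 1 => boolCombs ((List.range k).map .var ++ (level k n).map .dia)

theorem exists_successor_bisim {k n : ℕ} {L : List ML} {M N : PointedModel}
    (hL : ∀ K, ∃ χ ∈ L, ∀ K', χ.Sat K' ↔ Bisim k n K K')
    (h : ∀ χ ∈ L, (dia χ).Sat M → (dia χ).Sat N) {w : M.W} (hw : M.R M.pt w) :
    ∃ w', N.R N.pt w' ∧ Bisim k n (M.moveTo w) (N.moveTo w') := by
  obtain ⟨χ, hχ, hsat⟩ := hL (M.moveTo w)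
  obtain ⟨w', hw', hN⟩ := h χ hχ ⟨w, hw, (hsat _).2 (.refl k n _)⟩
  exact ⟨w', hw', (hsat _).1 hN⟩

theorem exists_mem_level (k n : ℕ) (P : PointedModel → Prop)
    (hP : ∀ M N, Bisim k n M N → (P M ↔ P N)) : ∃ χ ∈ level k n, ∀ M, χ.Sat M ↔ P M := by
  suffices ∃ χ ∈ level k n, ∀ M, True → (χ.Sat M ↔ P M) by simpa only [true_imp_iff] using this
  induction n generalizing P with
  | zero => exact exists_mem_boolCombs [] _ P fun M N _ _ _ => hP M N trivial
  | succ n ih =>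
    have hL (K : PointedModel) : ∃ χ ∈ level k n, ∀ K', χ.Sat K' ↔ Bisim k n K K' := by
      simpa only [true_imp_iff] using
        ih (Bisim k n K) fun _ _ h => ⟨fun hK => hK.trans h, fun hK => hK.trans h.symm⟩
    refine exists_mem_boolCombs _ _ P fun M N _ _ h => hP M N ?_
    obtain ⟨hvar, hdia⟩ := List.forall_mem_append.1 h
    rw [List.forall_mem_map] at hvar hdia
    refine ⟨fun p hp => hvar p (List.mem_range.2 hp), fun w hw => ?_, fun w' hw' => ?_⟩
    · exact exists_successor_bisim hL (fun χ hχ => (hdia χ hχ).1) hw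
    · obtain ⟨w, hw, hb⟩ := exists_successor_bisim hL (fun χ hχ => (hdia χ hχ).2) hw'
      exact ⟨w, hw, hb.symm⟩

end ML

theorem MLDefinable.exists_mem_level {k q x y : ℕ} (hxy : x ≠ y) {φ : FO} (hk : φ.symBound ≤ k)
    (hq : φ.qr ≤ q) (h : MLDefinable x y φ) : ∃ χ ∈ ML.level k (depthBound k q),
      φ.Entails (χ.st x y) ∧ (χ.st x y).Entails φ := by
  obtain ⟨χ, hφχ, hχφ⟩ := h
  have hχ : χ.TypeInvariant k q :=
    ML.typeInvariant_of_sat_iff hxy hk hq fun A v => ⟨hφχ A v, hχφ A v⟩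
  obtain ⟨χ', hmem, hsat⟩ := ML.exists_mem_level k _ χ.Sat fun _ _ => hχ.sat_iff_of_bisim
  have hst (A : Struc) (v : ℕ → A.dom) : (χ'.st x y).Sat A v ↔ (χ.st x y).Sat A v := by
    rw [ML.sat_st hxy, ML.sat_st hxy, hsat]
  exact ⟨χ', hmem, fun A v hφ => (hst A v).2 (hφχ A v hφ), fun A v h => hχφ A v ((hst A v).1 h)⟩

/-! ## Computability -/

open Primrec in
theorem primrec_decisionTrees {α : Type} [Primcodable α] {branch : α → α → α → α}
    (hbranch : Primrec fun t : α × α × α => branch t.1 t.2.1 t.2.2) (leaves : List α) :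
    Primrec (decisionTrees branch leaves) :=
  list_foldr Primrec.id (const leaves) <| Primrec.to₂ <|
    list_flatMap (snd.comp snd) <| Primrec.to₂ <| list_map (snd.comp (snd.comp fst)) <|
      Primrec.to₂ <|
        hbranch.comp (pair (fst.comp (snd.comp (fst.comp fst))) (pair (snd.comp fst) snd))

open Primrec in
theorem primrec_depthBound : Primrec₂ depthBound := by
  have two_pow : Primrec (2 ^ · : ℕ → ℕ) :=
    (Primrec₂.unpaired'.1 Nat.Primrec.pow).comp (const 2) Primrec.id
  have q_succ : Primrec fun t : ℕ × ℕ => 1 + t.2 := nat_add.comp (const 1) snd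
  have exponent : Primrec fun t : ℕ × ℕ => 2 * (1 + t.2) ^ 2 + t.1 * (1 + t.2) :=
    nat_add.comp
      (nat_mul.comp (const 2) ((Primrec₂.unpaired'.1 Nat.Primrec.pow).comp q_succ (const 2)))
      (nat_mul.comp fst q_succ)
  have card : Primrec fun t : ℕ × ℕ => tyCard t.1 t.2 1 :=
    nat_iterate snd (two_pow.comp exponent) (two_pow.comp snd)
  exact nat_mul.comp card card

namespace FO

section Constructors

open Primrec

theorem primrec_and : Primrec₂ FO.and :=
  Primrec₂.encode_iff.1 <| (nat_add.comp (nat_mul.comp (const 5)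
    (Primrec₂.natPair.comp (Primrec.encode.comp fst) (Primrec.encode.comp snd))) (const 3) :
    Primrec fun p : FO × FO => 5 * Nat.pair (Encodable.encode p.1) (Encodable.encode p.2) + 3)

theorem primrec_not : Primrec FO.not :=
  Primrec.encode_iff.1 <| (nat_add.comp (nat_mul.comp (const 5) Primrec.encode) (const 4) :
    Primrec fun φ : FO => 5 * Encodable.encode φ + 4)

theorem primrec_ex (x : ℕ) : Primrec (FO.ex x) :=
  Primrec.encode_iff.1 <| (nat_add.comp (nat_mul.comp (const 5)
    (Primrec₂.natPair.comp (const x) Primrec.encode)) (const 5) :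
    Primrec fun φ : FO => 5 * Nat.pair x (Encodable.encode φ) + 5)

theorem primrec_rel (args : List ℕ) : Primrec fun i => FO.rel i args :=
  Primrec.encode_iff.1 <| (nat_add.comp (nat_mul.comp (const 5)
    (Primrec₂.natPair.comp Primrec.id (const (Encodable.encode args)))) (const 1) :
    Primrec fun i : ℕ => 5 * Nat.pair i (Encodable.encode args) + 1)

end Constructors

/-- The first-order counterpart of `ML.branch`. -/
def branch (α β γ : FO) : FO := .not (.and (.not (.and α β)) (.not (.and (.not α) γ)))

open Primrec in
theorem primrec_branch : Primrec fun t : FO × FO × FO => branch t.1 t.2.1 t.2.2 :=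
  primrec_not.comp <| primrec_and.comp
    (primrec_not.comp (primrec_and.comp fst (fst.comp snd)))
    (primrec_not.comp (primrec_and.comp (primrec_not.comp fst) (snd.comp snd)))

/-- The standard translations of `ML.boolCombs`, computed from the standard translations `tests`. -/
def boolCombs (x : ℕ) (tests : List FO) : List FO :=
  decisionTrees branch [.eq x x, .not (.eq x x)] tests

theorem boolCombs_map_st (x y : ℕ) (tests : List ML) :
    boolCombs x (tests.map (ML.st · x y)) = (ML.boolCombs tests).map (ML.st · x y) :=
  (map_decisionTrees (ML.st · x y) (branch := ML.branch) (branch' := branch) (fun _ _ _ => rfl)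
    [.top, .not .top] tests).symm

/-- The standard translations of `ML.level k (n + 1)` with free variable `x`, computed from those
of `ML.level k n` with free variable `y`. -/
def nextLevel (k x y : ℕ) (L : List FO) : List FO :=
  boolCombs x ((List.range k).map (.rel · [x]) ++ L.map fun ψ => .ex y (.and (.rel 0 [x, y]) ψ))

theorem nextLevel_map_st (k n x y : ℕ) :
    nextLevel k x y ((ML.level k n).map (ML.st · y x)) =
      (ML.level k (n + 1)).map (ML.st · x y) := by
  rw [ML.level, ← boolCombs_map_st, nextLevel, List.map_append, List.map_map, List.map_map,
    List.map_map]
  rfl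

/-- The standard translations of `ML.level k n`, with the free variable `x` and with the free
variable `y`: each of the two lists needs the other one for the step to `n + 1`. -/
def levels (x y k n : ℕ) : List FO × List FO :=
  (fun L => (nextLevel k x y L.2, nextLevel k y x L.1))^[n] (boolCombs x [], boolCombs y [])

theorem levels_eq (x y k n : ℕ) :
    levels x y k n = ((ML.level k n).map (ML.st · x y), (ML.level k n).map (ML.st · y x)) := by
  induction n with
  | zero => exact Prod.ext (boolCombs_map_st x y []) (boolCombs_map_st y x [])
  | succ n ih =>
    rw [levels] at ih
    rw [levels, Function.iterate_succ_apply', ih, nextLevel_map_st, nextLevel_map_st]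

open Primrec in
theorem primrec_nextLevel (x y : ℕ) : Primrec₂ fun k L => nextLevel k x y L :=
  (primrec_decisionTrees primrec_branch _).comp <| list_append.comp
    (list_map (list_range.comp fst) ((primrec_rel [x]).comp snd))
    (list_map snd ((primrec_ex y).comp (primrec_and.comp (const (FO.rel 0 [x, y])) snd)))

open Primrec in
theorem primrec_levels (x y : ℕ) : Primrec₂ (levels x y) :=
  nat_iterate snd (const _) <| pair
    ((primrec_nextLevel x y).comp (fst.comp fst) (snd.comp snd))
    ((primrec_nextLevel y x).comp (fst.comp fst) (fst.comp snd))

/-- A computable finite list of standard translations among which there is a modal definition of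
`φ` if there is one at all. -/
def candidates (x y : ℕ) (φ : FO) : List FO :=
  (levels x y φ.encodeFO (depthBound φ.encodeFO φ.encodeFO)).1

theorem mem_candidates {x y : ℕ} {φ ψ : FO} : ψ ∈ candidates x y φ ↔
    ∃ χ ∈ ML.level φ.encodeFO (depthBound φ.encodeFO φ.encodeFO), χ.st x y = ψ := by
  rw [candidates, levels_eq, List.mem_map]

theorem mem_of_mem_candidates {F : Set FO} {x y : ℕ} (hF : ContainsML F x y) {φ ψ : FO}
    (hψ : ψ ∈ candidates x y φ) : ψ ∈ F := by
  obtain ⟨χ, -, rfl⟩ := mem_candidates.1 hψ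
  exact hF χ

theorem primrec_candidates (x y : ℕ) : Primrec (candidates x y) :=
  Primrec.fst.comp ((primrec_levels x y).comp Primrec.encode
    (primrec_depthBound.comp Primrec.encode Primrec.encode))

end FO

theorem mlDefinable_iff_exists_mem_candidates {x y : ℕ} (hxy : x ≠ y) (φ : FO) :
    MLDefinable x y φ ↔ ∃ ψ ∈ φ.candidates x y, φ.Entails ψ ∧ ψ.Entails φ := by
  constructor
  · intro h
    obtain ⟨χ, hχ, hφχ⟩ := h.exists_mem_level hxy φ.symBound_le_encodeFO φ.qr_le_encodeFO
    exact ⟨χ.st x y, FO.mem_candidates.2 ⟨χ, hχ, rfl⟩, hφχ⟩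
  · rintro ⟨ψ, hψ, hφψ⟩
    obtain ⟨χ, -, rfl⟩ := FO.mem_candidates.1 hψ
    exact ⟨χ, hφψ⟩

namespace DecidableOn

variable {α β : Type} [Primcodable α] [Primcodable β] {S : Set α} {P Q : α → Prop}

theorem congr (hP : DecidableOn S P) (h : ∀ a ∈ S, P a ↔ Q a) : DecidableOn S Q := by
  obtain ⟨f, hf, hfP⟩ := hP
  exact ⟨f, hf, fun a ha => (hfP a ha).imp fun _ hb => ⟨hb.1, hb.2.trans (h a ha)⟩⟩

theorem comp (hP : DecidableOn S P) {T : Set β} {g : β → α} (hg : Computable g)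
    (hT : Set.MapsTo g T S) : DecidableOn T fun b => P (g b) := by
  obtain ⟨f, hf, hfP⟩ := hP
  exact ⟨fun b => f (g b), hf.comp hg, fun b hb => hfP (g b) (hT hb)⟩

theorem and (hP : DecidableOn S P) (hQ : DecidableOn S Q) : DecidableOn S fun a => P a ∧ Q a := by
  obtain ⟨f, hf, hfP⟩ := hP
  obtain ⟨g, hg, hgQ⟩ := hQ
  refine ⟨fun a => (f a).bind fun b => (g a).map (b && ·), hf.bind ((hg.comp Computable.fst).map
    (Primrec.and.to_comp.comp (Computable.snd.comp Computable.fst) Computable.snd)), fun a ha => ?_⟩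
  obtain ⟨b, hb, hbP⟩ := hfP a ha
  obtain ⟨c, hc, hcQ⟩ := hgQ a ha
  exact ⟨b && c, Part.mem_bind hb (Part.mem_map _ hc), by rw [Bool.and_eq_true, hbP, hcQ]⟩

/-- The algorithm searches for the first index at which the list ends or has a suitable entry. -/
theorem exists_mem {T : Set (α × β)} {P : α × β → Prop} (hP : DecidableOn T P) {L : α → List β}
    (hL : Computable L) (hT : ∀ a ∈ S, ∀ b ∈ L a, (a, b) ∈ T) :
    DecidableOn S fun a => ∃ b ∈ L a, P (a, b) := by
  obtain ⟨f, hf, hfP⟩ := hP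
  let test (a : α) (n : ℕ) : Part Bool :=
    Option.casesOn (L a)[n]? (Part.some true) fun b => f (a, b)
  have htest : Partrec₂ test :=
    Partrec.optionCasesOn_right (Computable.list_getElem?.comp (hL.comp .fst) .snd) (.const true)
      (hf.comp (.pair (Computable.fst.comp .fst) .snd))
  have test_lt {a n} (hn : n < (L a).length) : test a n = f (a, (L a)[n]) := by
    simp only [test, List.getElem?_eq_getElem hn]
  have test_length (a) : test a (L a).length = Part.some true := by
    simp only [test, List.getElem?_length]
  refine ⟨fun a => (Nat.rfind (test a)).map fun n => decide (n < (L a).length),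
    (Partrec.rfind htest).map (Primrec.nat_lt.decide.to_comp.comp .snd
      (Computable.list_length.comp (hL.comp .fst))), fun a ha => ?_⟩
  have hspec {n} (hn : n < (L a).length) : ∃ b ∈ test a n, (b = true ↔ P (a, (L a)[n])) :=
    test_lt hn ▸ hfP _ (hT a ha _ (List.getElem_mem hn))
  obtain ⟨n, hn⟩ := Part.dom_iff_mem.1 <| Nat.rfind_dom.2 ⟨(L a).length,
    by rw [test_length]; exact Part.mem_some true,
    fun hm => Part.dom_iff_mem.2 ((hspec hm).imp fun _ h => h.1)⟩
  refine ⟨_, Part.mem_map _ hn, ?_⟩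
  obtain ⟨hfound, hbefore⟩ := Nat.mem_rfind.1 hn
  rw [decide_eq_true_iff]
  constructor
  · intro hlt
    obtain ⟨b, hb, hbP⟩ := hspec hlt
    exact ⟨_, List.getElem_mem hlt, hbP.1 (Part.mem_unique hb hfound)⟩
  · rintro ⟨_, hc, hPc⟩
    obtain ⟨i, hi, rfl⟩ := List.mem_iff_getElem.1 hc
    by_contra hlen
    obtain ⟨b, hb, hbP⟩ := hspec hi
    have hfalse : b = false := Part.mem_unique hb (hbefore (hi.trans_le (not_lt.1 hlen)))
    exact Bool.false_ne_true (hfalse ▸ hbP.2 hPc)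

end DecidableOn

theorem DecidableFragment.decidableOn_entails_and_entails {F : Set FO} (hF : DecidableFragment F) :
    DecidableOn (F ×ˢ F) fun p : FO × FO => p.1.Entails p.2 ∧ p.2.Entails p.1 :=
  DecidableOn.and hF <| DecidableOn.comp hF (.pair .snd .fst) fun _ hp => hp.symm

end ModalDefinability

theorem mainTheorem8 (x y : ℕ) (hxy : x ≠ y) (F : Set ModalDefinability.FO)
    (hF : ModalDefinability.DecidableFragment F) (hML : ModalDefinability.ContainsML F x y) :
    ModalDefinability.DecidableOn F (fun φ => ModalDefinability.MLDefinable x y φ) := by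
  have hdec : ModalDefinability.DecidableOn F
      fun φ => ∃ ψ ∈ φ.candidates x y, φ.Entails ψ ∧ ψ.Entails φ :=
    hF.decidableOn_entails_and_entails.exists_mem
      (ModalDefinability.FO.primrec_candidates x y).to_comp
      fun φ hφ ψ hψ => ⟨hφ, ModalDefinability.FO.mem_of_mem_candidates hML hψ⟩
  exact hdec.congr fun φ _ =>
    (ModalDefinability.mlDefinable_iff_exists_mem_candidates hxy φ).symm
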